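/- Let $T$ be a finite set of types with $c=|T|$, and let $m$ bidders have types drawn independently from a common probability distribution on $T$. There is a single item. A (feasible) mechanism assigns to each reported type profile $(A_1,\dots,A_m)\in T^m$ probabilities with which each bidder receives the item, summing to at most $1$. For a mechanism $M$, let $M_i(A)$ be the probability that bidder $i$ receives the item when reporting type $A$, over the randomness of $M$ and of the other bidders' types (truthfully reported). A bidder-symmetric reduced form is a function $\pi:T\to[0,1]$; it is feasible if some mechanism $M$ satisfies $M_i(A)\ge\pi(A)$ for all bidders $i$ and types $A$, and a mechanism $M$ exactly implements $\pi$ if $M_i(A)=\pi(A)$ for all $i$ and $A$. A hierarchical mechanism is given by a function $H:T\to\{1,\dots,c\}\cup\{\mathrm{LOSE}\}$, where $\mathrm{LOSE}$ is regarded as larger than $c$. On the profile $(A_1,\dots,A_m)$, it throws the item away if $H(A_i)=\mathrm{LOSE}$ for all $i$; otherwise it awards the item uniformly at random to a bidder in $\operatorname{argmin}_i H(A_i)$. It is well-ordered with respect to $\pi$ if $\pi(A)\ge\pi(A')$ implies $H(A)\le H(A')$ for all $A,A'\in T$. Theorem. Every feasible bidder-symmetric reduced form $\pi$ is exactly implemented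 by a mechanism that samples from some probability distribution over at most $c+1$ hierarchical mechanisms, all of which are well-ordered with respect to $\pi$, and runs the sampled one. -/

import Mathlib

namespace Auction

/-- A feasible single-item allocation rule for `m` bidders with types in `T`: on the reported type
profile `t`, bidder `i` receives the item with probability `alloc t i`, and the item is never
over-allocated. -/
structure Mechanism (T : Type*) (m : ℕ) where
  alloc : (Fin m → T) → Fin m → ℝ
  nonneg : ∀ t i, 0 ≤ alloc t i
  sum_le_one : ∀ t, ∑ i, alloc t i ≤ 1

/-- `M.interim p i A` is the probability `M_i(A)` that bidder `i` receives the item when reporting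
type `A`, the types of the other bidders being drawn independently from the distribution `p`:
the sum over all profiles `t` with `t i = A`, weighted by the probability of `t` restricted to
the bidders other than `i`. -/
def Mechanism.interim {T : Type*} [Fintype T] [DecidableEq T] {m : ℕ} (M : Mechanism T m)
    (p : T → ℝ) (i : Fin m) (A : T) : ℝ :=
  ∑ t : Fin m → T with t i = A, (∏ j ∈ Finset.univ.erase i, p (t j)) * M.alloc t i

/-- `M` implements the bidder-symmetric reduced form `π`: every bidder of every type receives the
item with at least the required probability. -/
def Mechanism.Implements {T : Type*} [Fintype T] [DecidableEq T] {m : ℕ} (M : Mechanism T m)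
    (p : T → ℝ) (π : T → ℝ) : Prop :=
  ∀ i A, π A ≤ M.interim p i A

/-- `M` exactly implements the bidder-symmetric reduced form `π`. -/
def Mechanism.ExactlyImplements {T : Type*} [Fintype T] [DecidableEq T] {m : ℕ}
    (M : Mechanism T m) (p : T → ℝ) (π : T → ℝ) : Prop :=
  ∀ i A, M.interim p i A = π A

/-- A bidder-symmetric reduced form is feasible for `m` bidders with types drawn i.i.d. from `p` if
some feasible mechanism implements it. -/
def Feasible {T : Type*} [Fintype T] [DecidableEq T] (m : ℕ) (p : T → ℝ) (π : T → ℝ) : Prop :=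
  ∃ M : Mechanism T m, M.Implements p π

/-- The function `H : T → [c] ∪ {LOSE}`, `c = |T|`, that specifies a hierarchical mechanism.
The top element `⊤` plays the role of `LOSE`. -/
abbrev Hierarchy (T : Type*) [Fintype T] : Type _ := T → WithTop (Fin (Fintype.card T))

namespace Hierarchy

/-- The bidders among whom the item is shared: empty if every bidder is mapped to `LOSE`, and the
set of minimizers of `H (t i)` otherwise. -/
def winners {T : Type*} [Fintype T] {m : ℕ} (H : Hierarchy T) (t : Fin m → T) : Finset (Fin m) :=
  {i | H (t i) ≠ ⊤ ∧ ∀ j, H (t i) ≤ H (t j)}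

/-- The hierarchical mechanism specified by `H`: the item is awarded uniformly at random to one of
the winners, and thrown away if there is none. -/
noncomputable def mechanism {T : Type*} [Fintype T] (H : Hierarchy T) (m : ℕ) :
    Mechanism T m where
  alloc t i := if i ∈ H.winners t then ((H.winners t).card : ℝ)⁻¹ else 0
  nonneg t i := by split_ifs <;> positivity
  sum_le_one t := by
    rw [Finset.sum_ite_mem, Finset.univ_inter, Finset.sum_const, nsmul_eq_mul]
    exact mul_inv_le_one

/-- `H` is well-ordered with respect to `π`. -/
def WellOrdered {T : Type*} [Fintype T] (H : Hierarchy T) (π : T → ℝ) : Prop :=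
  ∀ A A', π A' ≤ π A → H A ≤ H A'

end Hierarchy

/-- The mechanism that samples a hierarchical mechanism from the probability distribution `w` and
runs it. -/
noncomputable def hierarchyMixture {T : Type*} [Fintype T] [DecidableEq T] (m : ℕ)
    (w : stdSimplex ℝ (Hierarchy T)) : Mechanism T m where
  alloc t i := ∑ H : Hierarchy T, w.1 H * (H.mechanism m).alloc t i
  nonneg t i := Finset.sum_nonneg fun H _ =>
    mul_nonneg (w.2.1 H) ((H.mechanism m).nonneg t i)
  sum_le_one t := by
    rw [Finset.sum_comm]
    refine le_trans (Finset.sum_le_sum (g := fun H => w.1 H) fun H _ => ?_) w.2.2.le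
    rw [← Finset.mul_sum]
    exact mul_le_of_le_one_right (w.2.1 H) ((H.mechanism m).sum_le_one t)

end Auction

/-!
The interim allocations `r_H` of the hierarchical mechanisms which are well-ordered with respect to
`π` are points of `T → ℝ`, and mixing mechanisms amounts to taking convex combinations. So it is
enough to show that `π` lies in the convex hull of the `r_H`: Carathéodory's theorem then provides
`|T| + 1` of them (`exists_hierarchyMixture_of_mem_convexHull`).

The only consequences of feasibility that matter are Border's inequalities: the item goes to a
bidder with type in `S` with probability at most `hitProb m p S`, the probability that there is such
a bidder (`Mechanism.sum_interim_le_hitProb`). If `S` is a top segment of `H`, the hierarchical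
mechanism of `H` attains equality (`Hierarchy.sum_interim_eq_hitProb`).

Call `v : T → ℝ` a Border vector for `H` (`IsBorderVector`) if it decreases along `H` and satisfies
these inequalities on the top segments of `H`. A Border vector is in the convex hull of the `r_H'`,
`H'` being coarser than `H`, by induction on the number of levels of `H`
(`IsBorderVector.mem_convexHull`). Indeed, consider `v - α r_H` for `α` growing from `0`. Since
`r_H` makes Border's inequalities tight, `v' = (v - α r_H) / (1 - α)` still satisfies them. Either
monotonicity and nonnegativity survive until `α = 1`, and then the inequalities force `v = r_H`; or
for some `α < 1` two levels of `v'` become equal, or the value of a level drops to `0`. In this case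
`v'` is a Border vector for the coarser hierarchy that merges these two levels, or sends that level
to `LOSE`, and `v = α r_H + (1 - α) v'`.

Types of probability zero are invisible to the inequalities; for them the bound `v ≤ 1` on top
segments of probability zero, where `r_H = 1`, plays the same role.
-/

namespace Auction

variable {T : Type*} [Fintype T] [DecidableEq T] {m : ℕ} {p : T → ℝ}

/-! ### Interim allocation probabilities -/

/-- The product distribution of the other bidders' types has total mass one. -/
theorem sum_prod_erase_eq_one (hp : p ∈ stdSimplex ℝ T) (i : Fin m) (A : T) :
    ∑ t : Fin m → T with t i = A, ∏ j ∈ Finset.univ.erase i, p (t j) = 1 := by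
  -- conditioning on `t i = A` amounts to replacing the `i`-th marginal by a point mass at `A`
  have key : ∀ t : Fin m → T,
      (∏ j, (if j = i then Pi.single A (1 : ℝ) else p) (t j)) =
        if t i = A then ∏ j ∈ Finset.univ.erase i, p (t j) else 0 := by
    intro t
    rw [← Finset.mul_prod_erase _ _ (Finset.mem_univ i), if_pos rfl, Pi.single_apply, ite_mul,
      one_mul, zero_mul]
    congr 1
    refine Finset.prod_congr rfl fun j hj => ?_
    rw [if_neg (Finset.ne_of_mem_erase hj)]
  rw [Finset.sum_filter, ← Finset.sum_congr rfl fun t _ => key t,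
    ← Fintype.prod_sum fun j A' => (if j = i then Pi.single A (1 : ℝ) else p) A']
  refine Finset.prod_eq_one fun j _ => ?_
  split_ifs
  · simp
  · exact hp.2

/-- The probability that bidder `i` has a type in `S` and receives the item. -/
theorem Mechanism.sum_mul_interim (M : Mechanism T m) (i : Fin m) (S : Finset T) :
    ∑ A ∈ S, p A * M.interim p i A =
      ∑ t : Fin m → T, (∏ j, p (t j)) * if t i ∈ S then M.alloc t i else 0 := by
  have h : ∀ A, p A * M.interim p i A =
      ∑ t : Fin m → T, if t i = A then (∏ j, p (t j)) * M.alloc t i else 0 := by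
    intro A
    rw [Mechanism.interim, Finset.mul_sum, Finset.sum_filter]
    refine Finset.sum_congr rfl fun t _ => ?_
    split_ifs with hA
    · rw [← Finset.mul_prod_erase _ _ (Finset.mem_univ i), hA, mul_assoc]
    · rfl
  rw [Finset.sum_congr rfl fun A _ => h A, Finset.sum_comm]
  refine Finset.sum_congr rfl fun t _ => ?_
  rw [Finset.sum_ite_eq]
  split_ifs <;> simp

/-- The probability that some bidder has a type in `S`. -/
noncomputable def hitProb (m : ℕ) (p : T → ℝ) (S : Finset T) : ℝ :=
  ∑ t : Fin m → T, (∏ j, p (t j)) * if ∃ i, t i ∈ S then 1 else 0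

theorem Mechanism.sum_sum_mul_interim (M : Mechanism T m) (S : Finset T) :
    ∑ i, ∑ A ∈ S, p A * M.interim p i A =
      ∑ t : Fin m → T, (∏ j, p (t j)) * ∑ i, if t i ∈ S then M.alloc t i else 0 := by
  simp_rw [M.sum_mul_interim, Finset.mul_sum]
  exact Finset.sum_comm

/-- Border's inequality. -/
theorem Mechanism.sum_interim_le_hitProb (hp : p ∈ stdSimplex ℝ T) (M : Mechanism T m)
    (S : Finset T) : ∑ i, ∑ A ∈ S, p A * M.interim p i A ≤ hitProb m p S := by
  rw [M.sum_sum_mul_interim]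
  refine Finset.sum_le_sum fun t _ => mul_le_mul_of_nonneg_left ?_
    (Finset.prod_nonneg fun j _ => hp.1 _)
  split_ifs with h
  · refine le_trans (Finset.sum_le_sum fun i _ => ?_) (M.sum_le_one t)
    split_ifs
    · exact le_rfl
    · exact M.nonneg t i
  · exact (Finset.sum_eq_zero fun i _ => if_neg fun hi => h ⟨i, hi⟩).le

/-! ### Hierarchical mechanisms -/

namespace Hierarchy

variable (H : Hierarchy T)

omit [DecidableEq T] in
theorem mem_winners {t : Fin m → T} {i : Fin m} :
    i ∈ H.winners t ↔ H (t i) ≠ ⊤ ∧ ∀ j, H (t i) ≤ H (t j) := by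
  simp [winners]

/-- A bidder's winning probability depends only on the level of the reported type. -/
theorem interim_congr (i : Fin m) {A B : T} (h : H A = H B) :
    (H.mechanism m).interim p i A = (H.mechanism m).interim p i B := by
  unfold Mechanism.interim
  refine Finset.sum_bij' (fun t _ => Function.update t i B) (fun t _ => Function.update t i A)
    ?_ ?_ ?_ ?_ ?_
  · simp
  · simp
  · intro t ht
    simp only [Finset.mem_filter, Finset.mem_univ, true_and] at ht
    simp [← ht]
  · intro t ht
    simp only [Finset.mem_filter, Finset.mem_univ, true_and] at ht
    simp [← ht]
  · intro t ht
    simp only [Finset.mem_filter, Finset.mem_univ, true_and] at ht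
    have hH : ∀ j, H (Function.update t i B j) = H (t j) := by
      intro j
      by_cases hj : j = i
      · subst hj
        rw [Function.update_self, ht, h]
      · rw [Function.update_of_ne hj]
    have hw : H.winners (Function.update t i B) = H.winners t := by
      ext k
      simp only [mem_winners, hH]
    simp only [mechanism, hw]
    congr 1
    refine Finset.prod_congr rfl fun j hj => ?_
    rw [Function.update_of_ne (Finset.ne_of_mem_erase hj)]

/-- Hierarchical mechanisms treat all bidders alike. -/
theorem interim_eq_interim (i i' : Fin m) (A : T) :
    (H.mechanism m).interim p i A = (H.mechanism m).interim p i' A := by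
  unfold Mechanism.interim
  refine Finset.sum_equiv ((Equiv.swap i i').arrowCongr (Equiv.refl T)) ?_ ?_
  · intro t
    simp [Equiv.arrowCongr]
  · intro t _
    have hw : ∀ k, k ∈ H.winners (t ∘ Equiv.swap i i') ↔ Equiv.swap i i' k ∈ H.winners t := by
      intro k
      simp only [mem_winners, Function.comp_apply]
      rw [(Equiv.swap i i').forall_congr_left]
      simp
    have hc : (H.winners (t ∘ Equiv.swap i i')).card = (H.winners t).card :=
      Finset.card_equiv (Equiv.swap i i') fun k => hw k
    have ht : (Equiv.swap i i').arrowCongr (Equiv.refl T) t = t ∘ Equiv.swap i i' := by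
      ext j
      simp [Equiv.arrowCongr]
    rw [ht]
    simp only [mechanism, hw, hc, Equiv.swap_apply_right]
    congr 1
    refine Finset.prod_equiv (Equiv.swap i i') ?_ ?_
    · intro j
      simp [Equiv.swap_apply_eq_iff]
    · simp

theorem interim_of_eq_top (i : Fin m) {A : T} (h : H A = ⊤) :
    (H.mechanism m).interim p i A = 0 := by
  refine Finset.sum_eq_zero fun t ht => ?_
  have ht' : t i = A := (Finset.mem_filter.1 ht).2
  simp [mechanism, mem_winners, ht', h]

/-- `S` consists of the types at the uppermost levels of `H`, `LOSE` excluded. -/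
def IsTopSegment (S : Finset T) : Prop :=
  ∀ C ∈ S, H C ≠ ⊤ ∧ ∀ D, H D ≤ H C → D ∈ S

omit [DecidableEq T] in
theorem isTopSegment_le {A : T} (hA : H A ≠ ⊤) :
    H.IsTopSegment {C | H C ≤ H A} := by
  intro C hC
  simp only [Finset.mem_filter, Finset.mem_univ, true_and] at hC ⊢
  exact ⟨ne_top_of_le_ne_top hA hC, fun D hD => hD.trans hC⟩

variable {H}

theorem sum_alloc_of_isTopSegment {S : Finset T} (hS : H.IsTopSegment S) (t : Fin m → T) :
    (∑ i, if t i ∈ S then (H.mechanism m).alloc t i else 0) = if ∃ i, t i ∈ S then 1 else 0 := by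
  split_ifs with h
  · obtain ⟨i, hi⟩ := h
    -- winners rank at least as high as bidder `i`, so their types are in `S`
    have hwS : ∀ k ∈ H.winners t, t k ∈ S := fun k hk =>
      (hS _ hi).2 _ ((H.mem_winners.1 hk).2 i)
    have hne : (H.winners t).Nonempty := by
      obtain ⟨k, -, hk⟩ := Finset.exists_min_image Finset.univ (fun j => H (t j)) ⟨i, by simp⟩
      exact ⟨k, H.mem_winners.2 ⟨ne_top_of_le_ne_top (hS _ hi).1 (hk i (by simp)),
        fun j => hk j (by simp)⟩⟩
    have : ∀ k, (if t k ∈ S then (H.mechanism m).alloc t k else 0) =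
        if k ∈ H.winners t then ((H.winners t).card : ℝ)⁻¹ else 0 := by
      intro k
      by_cases hk : k ∈ H.winners t
      · simp [mechanism, hk, hwS k hk]
      · simp [mechanism, hk]
    rw [Finset.sum_congr rfl fun k _ => this k, Finset.sum_ite_mem, Finset.univ_inter,
      Finset.sum_const, nsmul_eq_mul]
    exact mul_inv_cancel₀ (by exact_mod_cast hne.card_ne_zero)
  · exact Finset.sum_eq_zero fun i _ => if_neg fun hi => h ⟨i, hi⟩

/-- A hierarchical mechanism attains equality in Border's inequality on its top segments: it sells
to a type in `S` whenever one is present. -/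
theorem sum_interim_eq_hitProb {S : Finset T} (hS : H.IsTopSegment S) :
    ∑ i, ∑ A ∈ S, p A * (H.mechanism m).interim p i A = hitProb m p S := by
  rw [Mechanism.sum_sum_mul_interim]
  simp_rw [sum_alloc_of_isTopSegment hS]
  rfl

/-- If the types in a top segment almost surely do not occur, then a bidder reporting one of them
is almost surely the only such bidder, and wins. -/
theorem interim_eq_one_of_null (hp : p ∈ stdSimplex ℝ T) {S : Finset T} (hS : H.IsTopSegment S)
    (hnull : ∀ C ∈ S, p C = 0) (i : Fin m) {A : T} (hA : A ∈ S) :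
    (H.mechanism m).interim p i A = 1 := by
  rw [← sum_prod_erase_eq_one hp i A]
  refine Finset.sum_congr rfl fun t ht => ?_
  have hti : t i = A := (Finset.mem_filter.1 ht).2
  by_cases h : ∃ j, j ≠ i ∧ t j ∈ S
  · obtain ⟨j, hji, hj⟩ := h
    rw [Finset.prod_eq_zero (Finset.mem_erase.2 ⟨hji, Finset.mem_univ j⟩) (hnull _ hj), zero_mul]
  · have hsum := sum_alloc_of_isTopSegment hS t
    rw [if_pos ⟨i, hti ▸ hA⟩, Finset.sum_eq_single i, if_pos (hti ▸ hA)] at hsum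
    · rw [hsum, mul_one]
    · exact fun j _ hj => if_neg fun hjS => h ⟨j, hj, hjS⟩
    · simp

end Hierarchy

/-! ### Border vectors and merging of levels -/

/-- Border's inequalities for `v`, relative to a hierarchy `H` along which `v` decreases. -/
structure IsBorderVector (m : ℕ) (p : T → ℝ) (H : Hierarchy T) (v : T → ℝ) : Prop where
  anti : ∀ A B, H A ≤ H B → v B ≤ v A
  nonneg : ∀ A, 0 ≤ v A
  lose : ∀ A, H A = ⊤ → v A = 0
  mass : ∀ S, H.IsTopSegment S → m * ∑ A ∈ S, p A * v A ≤ hitProb m p S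
  null : ∀ S, H.IsTopSegment S → (∀ C ∈ S, p C = 0) → ∀ A ∈ S, v A ≤ 1

namespace Hierarchy

/-- Merge all levels between `a` and `b` into level `b`. -/
def merge (H : Hierarchy T) (a b : WithTop (Fin (Fintype.card T))) : Hierarchy T :=
  fun C => if a ≤ H C ∧ H C ≤ b then b else H C

variable {H : Hierarchy T} {a b : WithTop (Fin (Fintype.card T))}

omit [DecidableEq T] in
theorem merge_le_merge {C D : T} (h : H C ≤ H D) : H.merge a b C ≤ H.merge a b D := by
  unfold merge
  split_ifs with h1 h2 h2
  · exact le_rfl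
  · exact le_of_not_ge fun h3 => h2 ⟨h1.1.trans h, h3⟩
  · exact h.trans h2.2
  · exact h

omit [DecidableEq T] in
theorem le_merge (C : T) : H C ≤ H.merge a b C := by
  unfold merge
  split_ifs with h
  · exact h.2
  · exact le_rfl

omit [DecidableEq T] in
theorem eq_or_mem_of_merge_eq {C D : T} (h : H.merge a b C = H.merge a b D) (hab : a ≤ b) :
    H C = H D ∨ ((a ≤ H C ∧ H C ≤ b) ∧ (a ≤ H D ∧ H D ≤ b)) := by
  unfold merge at h
  split_ifs at h with h1 h2 h2
  · exact Or.inr ⟨h1, h2⟩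
  · exact absurd ⟨h ▸ hab, h.ge⟩ h2
  · exact absurd ⟨h ▸ hab, h.le⟩ h1
  · exact Or.inl h

omit [DecidableEq T] in
theorem merge_wellOrdered {π : T → ℝ} (hH : H.WellOrdered π) : (H.merge a b).WellOrdered π :=
  fun A A' h => merge_le_merge (hH A A' h)

omit [DecidableEq T] in
theorem IsTopSegment.of_merge {S : Finset T} (hS : (H.merge a b).IsTopSegment S) :
    H.IsTopSegment S := fun C hC =>
  ⟨ne_top_of_le_ne_top (hS C hC).1 (le_merge C), fun D hD => (hS C hC).2 D (merge_le_merge hD)⟩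

/-- The number of levels of `H` in use, not counting `LOSE`. -/
def numLevels (H : Hierarchy T) : ℕ := ((Finset.univ.image H).erase ⊤).card

omit [DecidableEq T] in
theorem numLevels_merge_lt {A : T} (hab : H A < b) (hb : b = ⊤ ∨ b ∈ Finset.univ.image H) :
    (H.merge (H A) b).numLevels < H.numLevels := by
  refine Finset.card_lt_card (Finset.ssubset_iff_of_subset ?_ |>.2 ⟨H A, ?_, ?_⟩)
  · intro x hx
    obtain ⟨hx, hxi⟩ := Finset.mem_erase.1 hx
    obtain ⟨C, -, rfl⟩ := Finset.mem_image.1 hxi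
    refine Finset.mem_erase.2 ⟨hx, ?_⟩
    unfold merge at hx ⊢
    split_ifs at hx ⊢ with h
    · exact hb.resolve_left hx
    · exact Finset.mem_image_of_mem _ (Finset.mem_univ C)
  · exact Finset.mem_erase.2 ⟨hab.ne_top, Finset.mem_image_of_mem _ (Finset.mem_univ A)⟩
  · intro hx
    obtain ⟨C, -, hC⟩ := Finset.mem_image.1 (Finset.mem_erase.1 hx).2
    unfold merge at hC
    split_ifs at hC with h
    · exact hab.ne' hC
    · exact h ⟨hC.ge, hC ▸ hab.le⟩

end Hierarchy

/-- If `v` takes the same value at two levels, these levels can be merged. -/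
theorem IsBorderVector.merge {H : Hierarchy T} {v : T → ℝ} (hv : IsBorderVector m p H v)
    {a b : WithTop (Fin (Fintype.card T))} (hab : a ≤ b)
    {x : ℝ} (hx : ∀ C, a ≤ H C → H C ≤ b → v C = x) (hb : b = ⊤ → x = 0) :
    IsBorderVector m p (H.merge a b) v where
  anti A B h := by
    rcases le_total (H A) (H B) with h' | h'
    · exact hv.anti A B h'
    · rcases Hierarchy.eq_or_mem_of_merge_eq
        (h.antisymm (Hierarchy.merge_le_merge h')) hab with h2 | ⟨h2, h3⟩
      · exact hv.anti A B h2.le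
      · rw [hx A h2.1 h2.2, hx B h3.1 h3.2]
  nonneg := hv.nonneg
  lose A h := by
    unfold Hierarchy.merge at h
    split_ifs at h with h1
    · rw [hx A h1.1 h1.2, hb h]
    · exact hv.lose A h
  mass S hS := hv.mass S hS.of_merge
  null S hS := hv.null S hS.of_merge

/-! ### Decomposition of Border vectors -/

/-- Following the ray `a - α b` from the nonnegative vector `a`, either the orthant is not left
before `α = 1`, or some coordinate vanishes for the first time at some `α < 1`. -/
theorem exists_first_exit {κ : Type*} (s : Finset κ) (a b : κ → ℝ) (ha : ∀ k ∈ s, 0 ≤ a k) :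
    (∀ k ∈ s, b k ≤ a k) ∨ ∃ α : ℝ, 0 ≤ α ∧ α < 1 ∧ (∀ k ∈ s, α * b k ≤ a k) ∧
      ∃ k ∈ s, a k = α * b k ∧ b k ≠ 0 := by
  classical
  by_cases h : ∀ k ∈ s, b k ≤ a k
  · exact Or.inl h
  right
  push Not at h
  obtain ⟨k₀, hk₀, hlt₀⟩ := h
  obtain ⟨k, hk, hmin⟩ := Finset.exists_min_image (s.filter fun k => a k < b k)
    (fun k => a k / b k) ⟨k₀, Finset.mem_filter.2 ⟨hk₀, hlt₀⟩⟩
  obtain ⟨hks, hlt⟩ := Finset.mem_filter.1 hk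
  have hbk : 0 < b k := (ha k hks).trans_lt hlt
  have hα0 : 0 ≤ a k / b k := div_nonneg (ha k hks) hbk.le
  have hα1 : a k / b k < 1 := (div_lt_one hbk).2 hlt
  refine ⟨a k / b k, hα0, hα1, fun l hl => ?_, k, hks, (div_mul_cancel₀ _ hbk.ne').symm, hbk.ne'⟩
  rcases lt_or_ge (a l) (b l) with hl' | hl'
  · have hbl : 0 < b l := (ha l hl).trans_lt hl'
    exact (le_div_iff₀ hbl).1 (hmin l (Finset.mem_filter.2 ⟨hl, hl'⟩))
  · rcases le_total (b l) 0 with h0 | h0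
    · exact (mul_nonpos_of_nonneg_of_nonpos hα0 h0).trans (ha l hl)
    · exact (mul_le_of_le_one_left h0 hα1.le).trans hl'

theorem Hierarchy.mul_sum_interim_eq_hitProb {H : Hierarchy T} {S : Finset T}
    (hS : H.IsTopSegment S) (i : Fin m) :
    m * ∑ A ∈ S, p A * (H.mechanism m).interim p i A = hitProb m p S := by
  rw [← Hierarchy.sum_interim_eq_hitProb hS]
  simp_rw [fun i' A => H.interim_eq_interim (p := p) i' i A]
  simp

/-- A Border vector which exceeds `r_H` by something decreasing along `H` equals `r_H`. -/
theorem IsBorderVector.eq_interim (hp : p ∈ stdSimplex ℝ T) (i : Fin m) {H : Hierarchy T}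
    {v : T → ℝ} (hv : IsBorderVector m p H v)
    (hanti : ∀ A B, H A ≤ H B → (H.mechanism m).interim p i A - (H.mechanism m).interim p i B ≤
      v A - v B) (hnn : ∀ A, (H.mechanism m).interim p i A ≤ v A) :
    v = (H.mechanism m).interim p i := by
  funext A
  refine le_antisymm ?_ (hnn A)
  by_cases hA : H A = ⊤
  · rw [hv.lose A hA, H.interim_of_eq_top i hA]
  have hS := H.isTopSegment_le hA
  set S : Finset T := {C | H C ≤ H A} with hSdef
  have hAS : A ∈ S := by simp [hSdef]
  by_cases hnull : ∀ C ∈ S, p C = 0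
  · rw [Hierarchy.interim_eq_one_of_null hp hS hnull i hAS]
    exact hv.null S hS hnull A hAS
  · push Not at hnull
    obtain ⟨C, hC, hpC⟩ := hnull
    have hm : (0 : ℝ) < m := by exact_mod_cast i.pos
    have hle : ∑ B ∈ S, p B * v B ≤ ∑ B ∈ S, p B * (H.mechanism m).interim p i B := by
      have := hv.mass S hS
      rw [← Hierarchy.mul_sum_interim_eq_hitProb hS i] at this
      exact le_of_mul_le_mul_left this hm
    have hterm : ∀ B ∈ S, p B * (H.mechanism m).interim p i B ≤ p B * v B :=
      fun B _ => mul_le_mul_of_nonneg_left (hnn B) (hp.1 B)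
    have hC' := (Finset.sum_eq_sum_iff_of_le hterm).1
      (le_antisymm (Finset.sum_le_sum hterm) hle) C hC
    have hvC := mul_left_cancel₀ hpC hC'
    have := hanti C A (by simpa [hSdef] using hC)
    linarith

/-- Removing a multiple of `r_H` preserves Border's inequalities, as `r_H` makes them tight. -/
theorem IsBorderVector.sub_interim (hp : p ∈ stdSimplex ℝ T) (i : Fin m) {H : Hierarchy T}
    {v : T → ℝ} (hv : IsBorderVector m p H v) {α : ℝ} (hα : α < 1)
    (hanti : ∀ A B, H A ≤ H B →
      α * ((H.mechanism m).interim p i A - (H.mechanism m).interim p i B) ≤ v A - v B)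
    (hnn : ∀ A, α * (H.mechanism m).interim p i A ≤ v A) :
    IsBorderVector m p H fun A => (v A - α * (H.mechanism m).interim p i A) / (1 - α) := by
  have hα' : 0 < 1 - α := sub_pos.2 hα
  refine ⟨fun A B h => ?_, fun A => ?_, fun A h => ?_, fun S hS => ?_, fun S hS hnull A hA => ?_⟩
  · rw [div_le_div_iff_of_pos_right hα']
    have := hanti A B h
    linarith
  · exact div_nonneg (sub_nonneg.2 (hnn A)) hα'.le
  · rw [hv.lose A h, H.interim_of_eq_top i h]
    simp
  · have h1 := hv.mass S hS
    have h2 := Hierarchy.mul_sum_interim_eq_hitProb (p := p) hS i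
    have h3 : ∑ A ∈ S, p A * ((v A - α * (H.mechanism m).interim p i A) / (1 - α)) =
        (∑ A ∈ S, p A * v A - α * ∑ A ∈ S, p A * (H.mechanism m).interim p i A) / (1 - α) := by
      rw [Finset.mul_sum, ← Finset.sum_sub_distrib, Finset.sum_div]
      exact Finset.sum_congr rfl fun A _ => by ring
    rw [h3, ← mul_div_assoc, div_le_iff₀ hα', mul_sub, mul_left_comm, h2]
    linarith
  · rw [Hierarchy.interim_eq_one_of_null hp hS hnull i hA, div_le_one hα']
    have := hv.null S hS hnull A hA
    linarith

/-- A Border vector for a well-ordered hierarchy is a convex combination of interim allocations of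
well-ordered hierarchical mechanisms. -/
theorem IsBorderVector.mem_convexHull (hp : p ∈ stdSimplex ℝ T) (i : Fin m) {π : T → ℝ}
    {H : Hierarchy T} (hH : H.WellOrdered π) {v : T → ℝ} (hv : IsBorderVector m p H v) :
    v ∈ convexHull ℝ ((fun H : Hierarchy T => (H.mechanism m).interim p i) ''
      {H | H.WellOrdered π}) := by
  induction hn : H.numLevels using Nat.strong_induction_on generalizing H v with
  | _ n ih =>
    have hr : (H.mechanism m).interim p i ∈ convexHull ℝ
        ((fun H : Hierarchy T => (H.mechanism m).interim p i) '' {H | H.WellOrdered π}) :=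
      subset_convexHull _ _ ⟨H, hH, rfl⟩
    set r := (H.mechanism m).interim p i with hrdef
    -- `none` is a fictitious losing type: comparison with it expresses nonnegativity
    let val : (T → ℝ) → Option T → ℝ := fun u B => B.elim 0 u
    let lev : Option T → WithTop (Fin (Fintype.card T)) := fun B => B.elim ⊤ H
    have hval : ∀ A B, H A ≤ lev B → 0 ≤ v A - val v B := by
      rintro A (_ | B) h
      · simpa [val] using hv.nonneg A
      · simpa [val] using hv.anti A B h
    rcases exists_first_exit
        (Finset.univ.filter fun k : T × Option T => H k.1 ≤ lev k.2)
        (fun k => v k.1 - val v k.2) (fun k => r k.1 - val r k.2)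
        (fun k hk => hval _ _ (Finset.mem_filter.1 hk).2) with hall | hex
    · have heq : v = r := hv.eq_interim hp i
        (fun A B h => by simpa [val] using hall (A, some B) (by simpa [lev] using h))
        (fun A => by simpa [val] using hall (A, none) (by simp [lev]))
      exact heq ▸ hr
    · obtain ⟨α, hα0, hα1, hall, ⟨A, B⟩, hk, htight, hne⟩ := hex
      replace hk : H A ≤ lev B := (Finset.mem_filter.1 hk).2
      simp only at htight hne
      have hα' : 0 < 1 - α := sub_pos.2 hα1
      have hv' := hv.sub_interim hp i hα1
        (fun A B h => by simpa [val] using hall (A, some B) (by simpa [lev] using h))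
        (fun A => by simpa [val] using hall (A, none) (by simp [lev]))
      rw [← hrdef] at hv'
      set v' : T → ℝ := fun A => (v A - α * r A) / (1 - α) with hv'def
      have hvalv' : val v' B = (val v B - α * val r B) / (1 - α) := by
        cases B <;> simp [val, hv'def]
      have hAB : v' A = val v' B := by
        rw [hvalv']
        refine congrArg (· / (1 - α)) ?_
        linarith
      -- `r` takes the same value on types of the same level
      have hlt : H A < lev B := by
        refine lt_of_le_of_ne hk fun heq => hne ?_
        cases B with
        | none => simpa [val] using H.interim_of_eq_top (p := p) i heq
        | some B => simpa [val, sub_eq_zero] using H.interim_congr (p := p) i heq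
      have hconst : ∀ C, H A ≤ H C → H C ≤ lev B → v' C = v' A := by
        intro C h1 h2
        refine le_antisymm (hv'.anti A C h1) ?_
        rw [hAB]
        cases B with
        | none => exact hv'.nonneg C
        | some B => exact hv'.anti C B h2
      have hmerge := hv'.merge hlt.le hconst fun htop => by
        rw [hAB]
        cases B with
        | none => rfl
        | some B => exact hv'.lose B htop
      have hmem := ih _ (hn ▸ Hierarchy.numLevels_merge_lt hlt (by
        cases B with
        | none => exact Or.inl rfl
        | some B => exact Or.inr (Finset.mem_image_of_mem _ (Finset.mem_univ B))))
        (Hierarchy.merge_wellOrdered hH) hmerge rfl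
      have hcomb : v = α • r + (1 - α) • v' := by
        funext C
        simp only [hv'def, Pi.add_apply, Pi.smul_apply, smul_eq_mul]
        field_simp
        ring
      rw [hcomb]
      exact convex_convexHull ℝ _ hr hmem hα0 hα'.le (by ring)

/-! ### Mixtures of hierarchical mechanisms -/

theorem interim_hierarchyMixture (w : stdSimplex ℝ (Hierarchy T)) (i : Fin m) (A : T) :
    (hierarchyMixture m w).interim p i A =
      ∑ H : Hierarchy T, w.1 H * (H.mechanism m).interim p i A := by
  simp only [Mechanism.interim, hierarchyMixture, Finset.mul_sum]
  rw [Finset.sum_comm]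
  exact Finset.sum_congr rfl fun H _ => Finset.sum_congr rfl fun t _ => by ring

/-- By Carathéodory's theorem, a point of the convex hull of the interim allocations of the
hierarchies in `K` is realized by a mixture of at most `|T| + 1` of them. -/
theorem exists_hierarchyMixture_of_mem_convexHull (i : Fin m) {K : Set (Hierarchy T)} {v : T → ℝ}
    (hv : v ∈ convexHull ℝ ((fun H : Hierarchy T => (H.mechanism m).interim p i) '' K)) :
    ∃ w : stdSimplex ℝ (Hierarchy T), (Function.support w.1).ncard ≤ Fintype.card T + 1 ∧
      Function.support w.1 ⊆ K ∧ ∀ A, (hierarchyMixture m w).interim p i A = v A := by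
  obtain ⟨ι, _, z, c, hz, hind, hc0, hc1, hsum⟩ := eq_pos_convex_span_of_mem_convexHull hv
  choose G hGK hGz using fun k => hz (Set.mem_range_self k)
  have hsupp : Function.support (fun H => ∑ k, if G k = H then c k else 0) ⊆ Set.range G := by
    intro H hH
    obtain ⟨k, -, hk⟩ := Finset.exists_ne_zero_of_sum_ne_zero hH
    exact ⟨k, by_contra fun hne => hk (if_neg hne)⟩
  refine ⟨⟨fun H => ∑ k, if G k = H then c k else 0, fun H => Finset.sum_nonneg fun k _ => ?_, ?_⟩,
    ?_, ?_, fun A => ?_⟩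
  · split_ifs
    · exact (hc0 k).le
    · exact le_rfl
  · rw [Finset.sum_comm]
    simpa using hc1
  · refine (Set.ncard_le_ncard hsupp (Set.finite_range G)).trans ?_
    rw [← Set.image_univ]
    refine (Set.ncard_image_le Set.finite_univ).trans ?_
    rw [Set.ncard_univ, Nat.card_eq_fintype_card]
    refine hind.card_le_finrank_succ.trans (Nat.succ_le_succ ?_)
    exact (Submodule.finrank_le _).trans (Module.finrank_fintype_fun_eq_card ℝ).le
  · rintro H hH
    obtain ⟨k, rfl⟩ := hsupp hH
    exact hGK k
  · rw [interim_hierarchyMixture, ← hsum]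
    simp only [Finset.sum_mul, Finset.sum_apply, Pi.smul_apply, smul_eq_mul]
    rw [Finset.sum_comm]
    refine Finset.sum_congr rfl fun k _ => ?_
    rw [← hGz k]
    simp [ite_mul]

/-! ### The hierarchy that ranks types by `π` -/

omit [DecidableEq T] in
/-- Each type is ranked by the number of values of `π` above its own. -/
theorem exists_hierarchy_le_iff (π : T → ℝ) :
    ∃ H : Hierarchy T, (∀ A, H A ≠ ⊤) ∧ ∀ A B, H A ≤ H B ↔ π B ≤ π A := by
  let above : T → Finset ℝ := fun A => (Finset.univ.image π).filter fun x => π A < x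
  have hcard : ∀ A, (above A).card < Fintype.card T := fun A =>
    (Finset.card_lt_card (Finset.filter_ssubset.2
      ⟨π A, Finset.mem_image_of_mem _ (Finset.mem_univ A), lt_irrefl _⟩)).trans_le
      Finset.card_image_le
  refine ⟨fun A => ((⟨(above A).card, hcard A⟩ : Fin (Fintype.card T)) : WithTop _),
    fun A => WithTop.coe_ne_top, fun A B => ?_⟩
  rw [WithTop.coe_le_coe, Fin.mk_le_mk]
  refine ⟨fun h => le_of_not_gt fun hlt => h.not_gt ?_, fun h => Finset.card_le_card ?_⟩
  · refine Finset.card_lt_card (Finset.ssubset_iff_of_subset ?_ |>.2 ⟨π B, ?_, ?_⟩)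
    · exact Finset.monotone_filter_right _ fun x _ hx => hlt.trans hx
    · exact Finset.mem_filter.2 ⟨Finset.mem_image_of_mem _ (Finset.mem_univ B), hlt⟩
    · simp [above]
  · exact Finset.monotone_filter_right _ fun x _ hx => h.trans_lt hx

end Auction

theorem mainTheorem4 {T : Type*} [Fintype T] [DecidableEq T] (m : ℕ)
    (p : T → ℝ) (hp : p ∈ stdSimplex ℝ T)
    (π : T → ℝ) (hπ : ∀ A, π A ∈ Set.Icc (0 : ℝ) 1)
    (hfeas : Auction.Feasible m p π) :
    ∃ w : stdSimplex ℝ (Auction.Hierarchy T),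
      (Function.support w.1).ncard ≤ Fintype.card T + 1 ∧
      (∀ H ∈ Function.support w.1, Auction.Hierarchy.WellOrdered H π) ∧
      (Auction.hierarchyMixture m w).ExactlyImplements p π := by
  obtain ⟨H, hHtop, hHle⟩ := Auction.exists_hierarchy_le_iff π
  have hH : H.WellOrdered π := fun A A' h => (hHle A A').2 h
  obtain ⟨M, hM⟩ := hfeas
  rcases Nat.eq_zero_or_pos m with rfl | hm
  · -- without bidders there is nothing to implement, and a point mass will do
    have hsupp : Function.support (Pi.single H (1 : ℝ)) ⊆ {H} := by
      intro H' h
      by_contra hne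
      exact h (Pi.single_eq_of_ne hne _)
    refine ⟨⟨Pi.single H 1, single_mem_stdSimplex ℝ H⟩, ?_, ?_, fun i => i.elim0⟩
    · exact (Set.ncard_le_ncard hsupp).trans (by simp)
    · intro H' h
      rw [Set.mem_singleton_iff.1 (hsupp h)]
      exact hH
  · let i : Fin m := ⟨0, hm⟩
    have hborder : Auction.IsBorderVector m p H π :=
      { anti := fun A B h => (hHle A B).1 h
        nonneg := fun A => (hπ A).1
        lose := fun A h => absurd h (hHtop A)
        mass := fun S _ => by
          refine le_trans ?_ (M.sum_interim_le_hitProb hp S)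
          have : (m : ℝ) * ∑ A ∈ S, p A * π A = ∑ _i : Fin m, ∑ A ∈ S, p A * π A := by simp
          rw [this]
          exact Finset.sum_le_sum fun j _ => Finset.sum_le_sum fun A _ =>
            mul_le_mul_of_nonneg_left (hM j A) (hp.1 A)
        null := fun _ _ _ A _ => (hπ A).2 }
    obtain ⟨w, hcard, hsub, hw⟩ := Auction.exists_hierarchyMixture_of_mem_convexHull i
      (hborder.mem_convexHull hp i hH)
    refine ⟨w, hcard, fun H' h => hsub h, fun j A => ?_⟩
    rw [← hw A, Auction.interim_hierarchyMixture, Auction.interim_hierarchyMixture]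
    exact Finset.sum_congr rfl fun H' _ => by rw [H'.interim_eq_interim j i]
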